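/- **Setting.** Let $\mathcal A$ be a unital C*-algebra which is the C*-inductive limit of an increasing sequence of unital C*-subalgebras $\mathcal A_0\subset\mathcal A_1\subset\cdots$ with norm-dense union, where each $\mathcal A_k$ is realized, by a faithful unital *-representation, as an algebra of bounded operators on a Hilbert space $\mathcal H_k$ (e.g. $\mathcal A_k=\mathcal B(\mathcal H_k)$, as for quantum spin systems along an increasing sequence of finite regions exhausting the lattice, or an infinite tensor product over $\mathbb Z$ with $\mathcal A_k$ attached to the sites in $[-k,k]$). For $A\in\mathcal A$ we write $\pi_k(A)$ for the operator on $\mathcal H_k$ of an element $A_k\in\mathcal A_k$, where $(A_k)_k$ is any sequence with $\|A-A_k\|\to0$ (restriction of $A$ to the $k$-th finite subsystem). A vector $\xi\in\mathcal H_k$ defines the functional $\omega_\xi(a)=(\xi,a\,\xi)$ on $\mathcal A_k$, and $\|\omega_\xi-\omega_\eta\|=\sup\{|\omega_\xi(a)-\omega_\eta(a)|: a\in\mathcal A_k,\ \|a\|\le1\}$. For vectors $\xi_k\in\mathcal H_k$ that are normalized for large $k$ we say that $\omega_{\xi_k}\to\omega$ in the weak* topology if $(\xi_k,\pi_k(A)\xi_k)\to\omega(A)$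 for all $A\in\mathcal A$ and all choices of $\pi_k(A)$ (equivalently, states of $\mathcal A$ extending the $\omega_{\xi_k}$ converge weak* to $\omega$). If $\omega_{\xi_k}\to\omega$ and $\omega_{\eta_k}\to\omega'$ in the weak* topology, the *transition probability* between the states $\omega$ and $\omega'$ (along these sequences) is $$\omega\cdot\omega'=\lim_{k\to\infty}\Bigl(1-\tfrac14\|\omega_{\xi_k}-\omega_{\eta_k}\|^2\Bigr),$$ whenever this limit exists. Two states are *disjoint* if no nonzero subrepresentation of the GNS representation of the first is unitarily equivalent to a subrepresentation of that of the second, and *coherent* otherwise. A *folium* is a norm-closed convex set of states that contains, with a state $\omega$, all its local perturbations $\omega^{A}(B)=\omega(A^*BA)/\omega(A^*A)$, where $A\in\mathcal A$ and $\omega(A^*A)\neq0$; $[\omega]$ denotes the smallest folium containing $\omega$. **Corollary.** Let $\Psi^{k,\pm,T}\in\mathcal H_k$ be unit vectors (the apparatus vectors at the fixed measurement time $T$), and suppose that $\omega_{\Psi^{k,+,T}}\to\omega_1^T$ and $\omega_{\Psi^{k,-,T}}\to\omega_2^T$ in the weak* topology, where $\omega_1^T$ and $\omega_2^T$ are disjoint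 states of $\mathcal A$. 1. For every $A\in\mathcal A$ with $\omega_2^T(A^*A)\ne0$, the local perturbation $\omega_2^{T,A}$ of $\omega_2^T$ by $A$ lies in the folium $[\omega_2^T]$ and is coherent with $\omega_2^T$. The states of the normalized vectors $\pi_k(A)\Psi^{k,-,T}/\|\pi_k(A)\Psi^{k,-,T}\|$ (defined for large $k$) converge to $\omega_2^{T,A}$ in the weak* topology, and the transition probability between $\omega_1^T$ and $\omega_2^{T,A}$ along $\Psi^{k,+,T}$ and these vectors exists and is zero. Moreover, the transition probability between $\omega_1^T$ and $\omega_2^{T,A}$ exists and is zero along every pair of sequences of vectors whose states converge to $\omega_1^T$ and $\omega_2^{T,A}$ in the weak* topology. 2. For every $A\in\mathcal A$ (also if $\omega_2^T(A^*A)=0$) and every choice of $\pi_k(A)$, $$\lim_{k\to\infty}\bigl(\Psi^{k,+,T},\pi_k(A)\,\Psi^{k,-,T}\bigr)=0,$$ i.e. the interference terms vanish in the limit of infinitely many degrees of freedom. -/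

import Mathlib

open Filter Topology
open scoped InnerProductSpace ComplexOrder

noncomputable section

namespace QuantumMeasurement

universe u v w

section States

variable (𝒜 : Type u) [CStarAlgebra 𝒜] [PartialOrder 𝒜] [StarOrderedRing 𝒜]

/-- The set of states of a unital C*-algebra: normalized positive linear functionals. -/
def State : Type u := {φ : 𝒜 →ₚ[ℂ] ℂ // φ 1 = 1}

variable {𝒜}

namespace State

instance : CoeFun (State 𝒜) (fun _ => 𝒜 → ℂ) := ⟨fun ω => ω.1⟩

/-- The GNS Hilbert space of a state. -/
abbrev GNSSpace (ω : State 𝒜) : Type u := ω.1.GNS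

/-- The GNS representation of a state. -/
def gnsRep (ω : State 𝒜) : 𝒜 →⋆ₐ[ℂ] (ω.GNSSpace →L[ℂ] ω.GNSSpace) := ω.1.gnsStarAlgHom

/-- The local perturbation `ω_A(B) = ω(A* B A) / ω(A* A)` of a state `ω` by an element `A` with
`ω(A* A) ≠ 0`. -/
def perturb (ω : State 𝒜) (A : 𝒜) (hA : ω (star A * A) ≠ 0) : State 𝒜 :=
  ⟨PositiveLinearMap.mk₀
    { toFun := fun B => ω.1 (star A * B * A) / ω.1 (star A * A)
      map_add' := fun B C => by rw [mul_add, add_mul, map_add, add_div]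
      map_smul' := fun c B => by
        rw [mul_smul_comm, smul_mul_assoc, map_smul, smul_eq_mul, RingHom.id_apply, smul_eq_mul,
          mul_div_assoc] }
    (fun B hB => by
      have h1 : 0 ≤ ω.1 (star A * B * A) := map_nonneg ω.1 (star_left_conjugate_nonneg hB A)
      have h2 : 0 ≤ ω.1 (star A * A) := map_nonneg ω.1 (star_mul_self_nonneg A)
      exact div_nonneg h1 h2),
   by
    change ω.1 (star A * 1 * A) / ω.1 (star A * A) = 1
    rw [mul_one]
    exact div_self hA⟩

theorem perturb_apply (ω : State 𝒜) (A : 𝒜) (hA : ω (star A * A) ≠ 0) (B : 𝒜) :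
    ω.perturb A hA B = ω (star A * B * A) / ω (star A * A) := rfl

end State

/-- Invariance of a closed subspace under a representation, i.e. the property that the restriction
of `π` to `K` is a subrepresentation. -/
def IsSubrep {H : Type v} [NormedAddCommGroup H] [InnerProductSpace ℂ H] [CompleteSpace H]
    (π : 𝒜 →⋆ₐ[ℂ] (H →L[ℂ] H)) (K : Submodule ℂ H) : Prop :=
  IsClosed (K : Set H) ∧ ∀ (A : 𝒜), ∀ ξ ∈ K, π A ξ ∈ K

/-- Disjointness of representations: no nonzero subrepresentation of `π₁` is unitarily equivalent
to a subrepresentation of `π₂`. The unitary equivalence `U : K₁ → K₂` intertwines the two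
restrictions. -/
def DisjointReps {H₁ : Type v} [NormedAddCommGroup H₁] [InnerProductSpace ℂ H₁] [CompleteSpace H₁]
    {H₂ : Type w} [NormedAddCommGroup H₂] [InnerProductSpace ℂ H₂] [CompleteSpace H₂]
    (π₁ : 𝒜 →⋆ₐ[ℂ] (H₁ →L[ℂ] H₁)) (π₂ : 𝒜 →⋆ₐ[ℂ] (H₂ →L[ℂ] H₂)) : Prop :=
  ∀ (K₁ : Submodule ℂ H₁) (K₂ : Submodule ℂ H₂) (h₁ : IsSubrep π₁ K₁) (_ : IsSubrep π₂ K₂)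
    (U : K₁ ≃ₗᵢ[ℂ] K₂),
    (∀ (A : 𝒜) (ξ : K₁), (U ⟨π₁ A ξ, h₁.2 A ξ ξ.2⟩ : H₂) = π₂ A (U ξ)) → K₁ = ⊥

/-- Two states are disjoint if their GNS representations are disjoint. -/
def DisjointStates (ω₁ ω₂ : State 𝒜) : Prop := DisjointReps ω₁.gnsRep ω₂.gnsRep

/-- Two states are coherent if they are not disjoint. -/
def CoherentStates (ω₁ ω₂ : State 𝒜) : Prop := ¬ DisjointStates ω₁ ω₂

/-- A folium: a norm-closed convex set of states which is stable under local perturbations. -/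
structure IsFolium (F : Set (State 𝒜)) : Prop where
  norm_closed : ∀ φ : State 𝒜,
    (∀ ε : ℝ, 0 < ε → ∃ ψ ∈ F, ∀ A : 𝒜, ‖φ A - ψ A‖ ≤ ε * ‖A‖) → φ ∈ F
  convex : ∀ φ ∈ F, ∀ ψ ∈ F, ∀ s t : ℝ, 0 ≤ s → 0 ≤ t → s + t = 1 →
    ∀ χ : State 𝒜, (∀ A : 𝒜, χ A = s * φ A + t * ψ A) → χ ∈ F
  perturb_mem : ∀ φ ∈ F, ∀ (A : 𝒜) (hA : φ (star A * A) ≠ 0), φ.perturb A hA ∈ F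

/-- The folium of a state `ω`: the smallest folium that contains `ω`. -/
def folium (ω : State 𝒜) : Set (State 𝒜) :=
  {φ | ∀ F : Set (State 𝒜), IsFolium F → ω ∈ F → φ ∈ F}

/-- States are contractive. -/
theorem State.norm_apply_le (ω : State 𝒜) (A : 𝒜) : ‖ω A‖ ≤ ‖A‖ := by
  have h1 : ω.1 1 = 1 := ω.2
  have hcs := norm_inner_le_norm (𝕜 := ℂ) (ω.1.toPreGNS 1) (ω.1.toPreGNS A)
  rw [PositiveLinearMap.preGNS_inner_def] at hcs
  simp only [PositiveLinearMap.ofPreGNS_toPreGNS, star_one, one_mul] at hcs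
  have hn1 : ‖ω.1.toPreGNS 1‖ = 1 := by
    rw [PositiveLinearMap.preGNS_norm_def]
    simp [h1]
  have hnA : ‖ω.1.toPreGNS A‖ ≤ ‖A‖ := by
    rw [PositiveLinearMap.preGNS_norm_def]
    simp only [PositiveLinearMap.ofPreGNS_toPreGNS]
    refine Real.sqrt_le_iff.mpr ⟨norm_nonneg _, ?_⟩
    have h2 := ω.1.norm_apply_le_of_nonneg (star A * A) (star_mul_self_nonneg A)
    rw [h1, norm_one, one_mul, CStarRing.norm_star_mul_self] at h2
    rw [sq]
    exact (Complex.re_le_norm _).trans h2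
  rw [hn1, one_mul] at hcs
  exact hcs.trans hnA

end States

/-- A presentation of the C*-algebra `𝒜` as the C*-inductive limit of an increasing sequence of
unital C*-algebras `𝒜 k`, each realized faithfully as an algebra of bounded operators on a Hilbert
space `H k`: isotony, and density of the local algebra `⋃ k, 𝒜 k` in norm. If `rep k` is
onto, `𝒜 k` is identified with the algebra of all bounded operators on `H k`. Quantum spin systems
(`𝒜 k` attached to an increasing sequence of finite regions exhausting the lattice, `H k` a tensor
product of copies of `ℂ²`) and infinite tensor products over `ℤ` (`𝒜 k` attached to the sites in
`[-k, k]`) are of this form. -/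
structure QuasilocalAlgebra (𝒜 : Type u) [CStarAlgebra 𝒜] (H : ℕ → Type v)
    [∀ k, NormedAddCommGroup (H k)] [∀ k, InnerProductSpace ℂ (H k)]
    [∀ k, CompleteSpace (H k)] where
  /-- The C*-subalgebra attached to the `k`-th finite subsystem. -/
  loc : ℕ → StarSubalgebra ℂ 𝒜
  isClosed_loc : ∀ k, IsClosed (loc k : Set 𝒜)
  isotony : Monotone loc
  dense_local : Dense (⋃ k, (loc k : Set 𝒜))
  /-- The representation of the `k`-th subalgebra by bounded operators. -/
  rep : ∀ k, loc k →⋆ₐ[ℂ] (H k →L[ℂ] H k)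
  rep_injective : ∀ k, Function.Injective (rep k)

namespace QuasilocalAlgebra

variable {𝒜 : Type u} [CStarAlgebra 𝒜] {H : ℕ → Type v} [∀ k, NormedAddCommGroup (H k)] [∀ k, InnerProductSpace ℂ (H k)]
  [∀ k, CompleteSpace (H k)]

/-- `a` is a sequence of restrictions of `A` to the finite subsystems: `a k` is a local
element of `𝒜 k`, and `‖A - a k‖` becomes arbitrarily small. The operator usually written `π_k(A)`
is then `Q.rep k (a k)`. -/
def IsRestriction (Q : QuasilocalAlgebra 𝒜 H) (A : 𝒜) (a : ∀ k, Q.loc k) : Prop :=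
  Tendsto (fun k => ‖A - (a k : 𝒜)‖) atTop (𝓝 0)

theorem exists_isRestriction (Q : QuasilocalAlgebra 𝒜 H) (A : 𝒜) :
    ∃ a : ∀ k, Q.loc k, Q.IsRestriction A a := by
  have hne : ∀ k, (Q.loc k : Set 𝒜).Nonempty := fun k => ⟨1, one_mem _⟩
  have key : ∀ k : ℕ, ∃ b : Q.loc k,
      ‖A - (b : 𝒜)‖ < Metric.infDist A (Q.loc k : Set 𝒜) + 1 / ((k : ℝ) + 1) := by
    intro k
    have hpos : (0 : ℝ) < 1 / ((k : ℝ) + 1) := by positivity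
    obtain ⟨b, hb, hlt⟩ := (Metric.infDist_lt_iff (hne k)).1
      (lt_add_of_pos_right (Metric.infDist A (Q.loc k : Set 𝒜)) hpos)
    exact ⟨⟨b, hb⟩, by rwa [dist_eq_norm] at hlt⟩
  choose a ha using key
  refine ⟨a, ?_⟩
  refine Metric.tendsto_atTop.2 fun ε hε => ?_
  obtain ⟨b, hb, hbd⟩ := Metric.dense_iff.1 Q.dense_local A (ε / 2) (half_pos hε)
  obtain ⟨m, hm⟩ := Set.mem_iUnion.1 hbd
  obtain ⟨n, hn⟩ := exists_nat_one_div_lt (half_pos hε)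
  refine ⟨max m n, fun k hk => ?_⟩
  have h1 : Metric.infDist A (Q.loc k : Set 𝒜) < ε / 2 := by
    refine (Metric.infDist_le_dist_of_mem (Q.isotony ((le_max_left m n).trans hk) hm)).trans_lt ?_
    rw [dist_comm]
    exact Metric.mem_ball.1 hb
  have h2 : 1 / ((k : ℝ) + 1) ≤ 1 / ((n : ℝ) + 1) := by
    have : (n : ℝ) ≤ k := by exact_mod_cast (le_max_right m n).trans hk
    gcongr
  rw [dist_zero_right, norm_norm]
  linarith [ha k]

/-- The functional `ω_ξ(a) = (ξ, a ξ)` on the local algebra `𝒜 k` defined by a vector of `H k`. -/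
def vectorFunctional (Q : QuasilocalAlgebra 𝒜 H) (k : ℕ) (ξ : H k) (a : Q.loc k) : ℂ :=
  ⟪ξ, Q.rep k a ξ⟫_ℂ

/-- The norm distance `‖ω_ξ - ω_η‖ = sup {|ω_ξ(a) - ω_η(a)| : a ∈ 𝒜 k, ‖a‖ ≤ 1}`. The set is
bounded, as `Q.rep k` does not increase norms. -/
def vectorDist (Q : QuasilocalAlgebra 𝒜 H) (k : ℕ) (ξ η : H k) : ℝ :=
  ⨆ a : {a : Q.loc k // ‖a‖ ≤ 1}, ‖Q.vectorFunctional k ξ a - Q.vectorFunctional k η a‖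

variable [PartialOrder 𝒜] [StarOrderedRing 𝒜]

/-- The vector states of `ξ k` converge to the state `ω` of `𝒜` in the weak* topology:
`(ξ k, π_k(A) ξ k) → ω(A)` for all `A`. The lemma `weakStarTendsto_iff` below shows that this is
weak* convergence of arbitrary extensions of the vector states to states of `𝒜`. The vectors need
to be normalized for large `k` only. -/
structure WeakStarTendsto (Q : QuasilocalAlgebra 𝒜 H) (ξ : ∀ k, H k) (ω : State 𝒜) : Prop where
  norm_eq_one : ∀ᶠ k in atTop, ‖ξ k‖ = 1
  tendsto : ∀ (A : 𝒜) (a : ∀ k, Q.loc k), Q.IsRestriction A a →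
    Tendsto (fun k => Q.vectorFunctional k (ξ k) (a k)) atTop (𝓝 (ω A))

/-- Convergence `(ξ k, π_k(A) ξ k) → ω(A)` is weak* convergence to `ω` of any states `φ k` of `𝒜`
that extend the vector states. -/
theorem weakStarTendsto_iff (Q : QuasilocalAlgebra 𝒜 H) (ξ : ∀ k, H k) (ω : State 𝒜)
    (hξ : ∀ᶠ k in atTop, ‖ξ k‖ = 1) (φ : ℕ → State 𝒜)
    (hφ : ∀ᶠ k in atTop, ∀ a : Q.loc k, φ k (a : 𝒜) = Q.vectorFunctional k (ξ k) a) :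
    Q.WeakStarTendsto ξ ω ↔ ∀ A : 𝒜, Tendsto (fun k => φ k A) atTop (𝓝 (ω A)) := by
  have key : ∀ (A : 𝒜) (a : ∀ k, Q.loc k), Q.IsRestriction A a →
      Tendsto (fun k => φ k A - Q.vectorFunctional k (ξ k) (a k)) atTop (𝓝 0) := by
    intro A a ha
    refine squeeze_zero_norm' ?_ ha
    filter_upwards [hφ] with k hk
    rw [← hk (a k)]
    have h := (φ k).norm_apply_le (A - (a k : 𝒜))
    rwa [map_sub] at h
  constructor
  · intro h A
    obtain ⟨a, ha⟩ := Q.exists_isRestriction A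
    simpa using (key A a ha).add (h.tendsto A a ha)
  · intro h
    refine ⟨hξ, fun A a ha => ?_⟩
    simpa using (h A).sub (key A a ha)

/-- `p` is the transition probability between `ω₁` and `ω₂`, computed along the
vector states of `ξ k` and `η k`, whose weak* limits are `ω₁` and `ω₂`: the limit of
`1 - ‖ω_{ξ k} - ω_{η k}‖² / 4` exists and equals `p`. -/
structure HasTransitionProbability (Q : QuasilocalAlgebra 𝒜 H) (ξ η : ∀ k, H k)
    (ω₁ ω₂ : State 𝒜) (p : ℝ) : Prop where
  left : Q.WeakStarTendsto ξ ω₁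
  right : Q.WeakStarTendsto η ω₂
  tendsto : Tendsto (fun k => 1 - (1 / 4 : ℝ) * Q.vectorDist k (ξ k) (η k) ^ 2) atTop (𝓝 p)

/-- The normalized vector `π_k(A) η / ‖π_k(A) η‖`, which defines the perturbed vector state
`B ↦ (η, π_k(A)* B π_k(A) η) / (η, π_k(A)* π_k(A) η)`. -/
def perturbVec (Q : QuasilocalAlgebra 𝒜 H) (a : ∀ k, Q.loc k) (η : ∀ k, H k) (k : ℕ) : H k :=
  ((‖Q.rep k (a k) (η k)‖⁻¹ : ℝ) : ℂ) • Q.rep k (a k) (η k)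

end QuasilocalAlgebra

end QuantumMeasurement

end

/-! Both parts come from separating vectors of disjoint representations. If `π` and `ρ` are
disjoint, then for vectors `ξ`, `η` and any tolerance there is a self-adjoint contraction `D` in the
algebra with `π(D)ξ ≈ -ξ` and `ρ(D)η ≈ η` (`DisjointReps.exists_contraction`).

To find `D`, one shows that `(0, η)` is a norm limit of vectors `(π(A)ξ, ρ(A)η)` with `A`
self-adjoint. Otherwise Hahn–Banach gives a vector `ζ` that is real-orthogonal to this orbit of `χ =
(ξ, η)` but pairs positively with `(0, η)`. Then `χ + ζ` and `χ - ζ` induce the same functional, so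
a contraction in the commutant carries `χ - ζ` to `χ + ζ`. Disjointness kills its off-diagonal
blocks, and comparing second components contradicts the positivity. Finally `2A - 1` is cut off to
the interval `[-1, 1]` by functional calculus.

A local perturbation of `ω₂` is a vector state in the GNS space of `ω₂`, so `D` makes its value near
`1` while `ω₁(D)` is near `-1`. Restrictions of `D` force the local norm distances to tend to `2`,
the maximum, along any approximating vectors. For the interference terms, `D` is moved across the
inner product: it acts nearly as `-1` on the left vector and as `1` on the right one, so the product
nearly equals its own negative. -/

noncomputable section

namespace QuantumMeasurement

universe u v w

/-! ### Operators on direct sums and identities for star representations. -/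

section DirectSum

variable {H : Type v} [NormedAddCommGroup H] [InnerProductSpace ℂ H]
  {H' : Type w} [NormedAddCommGroup H'] [InnerProductSpace ℂ H']

/-- The direct sum of two operators. -/
def prodOp (S : H →L[ℂ] H) (T : H' →L[ℂ] H') : WithLp 2 (H × H') →L[ℂ] WithLp 2 (H × H') :=
  (WithLp.prodContinuousLinearEquiv 2 ℂ H H').symm.toContinuousLinearMap ∘L
    (S.prodMap T) ∘L (WithLp.prodContinuousLinearEquiv 2 ℂ H H').toContinuousLinearMap

theorem prodOp_ext {R : WithLp 2 (H × H') →L[ℂ] WithLp 2 (H × H')} {S : H →L[ℂ] H}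
    {T : H' →L[ℂ] H'} (h₁ : ∀ ζ, S ζ.fst = (R ζ).fst) (h₂ : ∀ ζ, T ζ.snd = (R ζ).snd) :
    prodOp S T = R :=
  ContinuousLinearMap.ext fun ζ => WithLp.ofLp_injective 2 (Prod.ext (h₁ ζ) (h₂ ζ))

end DirectSum

section StarRepresentations

variable {ℬ : Type u} [Ring ℬ] [StarRing ℬ] [Algebra ℂ ℬ]
  {H : Type v} [NormedAddCommGroup H] [InnerProductSpace ℂ H] [CompleteSpace H]

theorem rep_inner_left (π : ℬ →⋆ₐ[ℂ] (H →L[ℂ] H)) (A : ℬ) (ξ η : H) :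
    ⟪π A ξ, η⟫_ℂ = ⟪ξ, π (star A) η⟫_ℂ := by
  rw [map_star, ContinuousLinearMap.star_eq_adjoint, ContinuousLinearMap.adjoint_inner_right]

theorem rep_norm_sq (π : ℬ →⋆ₐ[ℂ] (H →L[ℂ] H)) (A : ℬ) (ξ : H) :
    ((‖π A ξ‖ ^ 2 : ℝ) : ℂ) = ⟪ξ, π (star A * A) ξ⟫_ℂ := by
  rw [map_mul, mul_apply_eq_comp, ← rep_inner_left, inner_self_eq_norm_sq_to_K]
  simp

end StarRepresentations

/-! ### Cyclic subspaces, intertwiners and the commutant. -/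

section Representations

variable {𝒜 : Type u} [CStarAlgebra 𝒜]
  {H : Type v} [NormedAddCommGroup H] [InnerProductSpace ℂ H] [CompleteSpace H]
  {H' : Type w} [NormedAddCommGroup H'] [InnerProductSpace ℂ H'] [CompleteSpace H']

/-- The orbit map `A ↦ π(A) ξ` of a vector. -/
def orbitMap (π : 𝒜 →⋆ₐ[ℂ] (H →L[ℂ] H)) (ξ : H) : 𝒜 →ₗ[ℂ] H where
  toFun A := π A ξ
  map_add' A B := by simp
  map_smul' c A := by simp

@[simp]
theorem orbitMap_apply (π : 𝒜 →⋆ₐ[ℂ] (H →L[ℂ] H)) (ξ : H) (A : 𝒜) :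
    orbitMap π ξ A = π A ξ := rfl

/-- The cyclic subspace generated by a vector. -/
def cyclicSubspace (π : 𝒜 →⋆ₐ[ℂ] (H →L[ℂ] H)) (ξ : H) : Submodule ℂ H :=
  (LinearMap.range (orbitMap π ξ)).topologicalClosure

instance (π : 𝒜 →⋆ₐ[ℂ] (H →L[ℂ] H)) (ξ : H) : CompleteSpace (cyclicSubspace π ξ) :=
  (Submodule.isClosed_topologicalClosure _).completeSpace_coe

theorem rep_mem_cyclicSubspace (π : 𝒜 →⋆ₐ[ℂ] (H →L[ℂ] H)) (ξ : H) (A : 𝒜) :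
    π A ξ ∈ cyclicSubspace π ξ :=
  Submodule.le_topologicalClosure _ ⟨A, rfl⟩

theorem self_mem_cyclicSubspace (π : 𝒜 →⋆ₐ[ℂ] (H →L[ℂ] H)) (ξ : H) :
    ξ ∈ cyclicSubspace π ξ := by
  simpa using rep_mem_cyclicSubspace π ξ 1

theorem isSubrep_cyclicSubspace (π : 𝒜 →⋆ₐ[ℂ] (H →L[ℂ] H)) (ξ : H) :
    IsSubrep π (cyclicSubspace π ξ) := by
  refine ⟨Submodule.isClosed_topologicalClosure _, fun A η hη => ?_⟩
  refine map_mem_closure (π A).continuous hη ?_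
  rintro _ ⟨B, rfl⟩
  exact ⟨A * B, by simp⟩

/-- The orbit map with values in the cyclic subspace. -/
def cyclicOrbitMap (π : 𝒜 →⋆ₐ[ℂ] (H →L[ℂ] H)) (ξ : H) : 𝒜 →ₗ[ℂ] cyclicSubspace π ξ :=
  (orbitMap π ξ).codRestrict _ (rep_mem_cyclicSubspace π ξ)

@[simp]
theorem coe_cyclicOrbitMap (π : 𝒜 →⋆ₐ[ℂ] (H →L[ℂ] H)) (ξ : H) (A : 𝒜) :
    (cyclicOrbitMap π ξ A : H) = π A ξ := rfl

theorem denseRange_cyclicOrbitMap (π : 𝒜 →⋆ₐ[ℂ] (H →L[ℂ] H)) (ξ : H) :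
    DenseRange (cyclicOrbitMap π ξ) := by
  intro η
  rw [closure_subtype]
  have h : (η : H) ∈ closure (LinearMap.range (orbitMap π ξ) : Set H) := η.2
  refine closure_mono ?_ h
  rintro _ ⟨A, rfl⟩
  exact ⟨cyclicOrbitMap π ξ A, ⟨A, rfl⟩, rfl⟩

/-- Vectors which induce the same functional generate unitarily equivalent cyclic
subrepresentations. -/
theorem exists_cyclicSubspace_equiv (π : 𝒜 →⋆ₐ[ℂ] (H →L[ℂ] H)) (ρ : 𝒜 →⋆ₐ[ℂ] (H' →L[ℂ] H'))
    (ξ : H) (η : H') (h : ∀ A, ⟪ξ, π A ξ⟫_ℂ = ⟪η, ρ A η⟫_ℂ) :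
    ∃ U : cyclicSubspace π ξ ≃ₗᵢ[ℂ] cyclicSubspace ρ η,
      (∀ A : 𝒜, (U (cyclicOrbitMap π ξ A) : H') = ρ A η) ∧
      ∀ (A : 𝒜) (ζ : cyclicSubspace π ξ),
        (U ⟨π A ζ, (isSubrep_cyclicSubspace π ξ).2 A ζ ζ.2⟩ : H') = ρ A (U ζ) := by
  have hnorm : ∀ A, ‖cyclicOrbitMap ρ η A‖ = ‖cyclicOrbitMap π ξ A‖ := by
    intro A
    rw [Submodule.coe_norm, Submodule.coe_norm, coe_cyclicOrbitMap, coe_cyclicOrbitMap]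
    have h2 : ‖ρ A η‖ ^ 2 = ‖π A ξ‖ ^ 2 := by
      have := (rep_norm_sq ρ A η).trans ((h _).symm.trans (rep_norm_sq π A ξ).symm)
      exact_mod_cast this
    exact (pow_left_inj₀ (norm_nonneg _) (norm_nonneg _) two_ne_zero).1 h2
  have hd₁ := denseRange_cyclicOrbitMap π ξ
  have hd₂ := denseRange_cyclicOrbitMap ρ η
  -- By `hnorm`, `π(A)ξ ↦ ρ(A)η` is well defined and isometric on dense orbits, hence extends to the
  -- closures.
  let U := (LinearEquiv.refl ℂ 𝒜).extendOfIsometry (cyclicOrbitMap π ξ) (cyclicOrbitMap ρ η)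
    hd₁ hd₂ hnorm
  have hU : ∀ A, U (cyclicOrbitMap π ξ A) = cyclicOrbitMap ρ η A := fun A =>
    LinearMap.extendOfNorm_eq hd₁ ⟨1, fun B => by simpa using (hnorm B).le⟩ A
  refine ⟨U, fun A => by rw [hU]; rfl, fun A ζ => ?_⟩
  have hc₁ : Continuous fun ζ : cyclicSubspace π ξ =>
      (U ⟨π A ζ, (isSubrep_cyclicSubspace π ξ).2 A ζ ζ.2⟩ : H') :=
    continuous_subtype_val.comp (U.continuous.comp
      (((π A).continuous.comp continuous_subtype_val).subtype_mk _))
  have hc₂ : Continuous fun ζ : cyclicSubspace π ξ => ρ A (U ζ) :=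
    (ρ A).continuous.comp (continuous_subtype_val.comp U.continuous)
  refine congrFun (hd₁.equalizer hc₁ hc₂ (funext fun B => ?_)) ζ
  have h1 : (⟨π A (cyclicOrbitMap π ξ B), (isSubrep_cyclicSubspace π ξ).2 A _
      (cyclicOrbitMap π ξ B).2⟩ : cyclicSubspace π ξ) = cyclicOrbitMap π ξ (A * B) := by
    ext
    simp
  simp only [Function.comp_apply]
  rw [h1, hU, hU]
  simp

/-- Every intertwiner between disjoint representations vanishes. -/
theorem DisjointReps.intertwiner_eq_zero {π : 𝒜 →⋆ₐ[ℂ] (H →L[ℂ] H)}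
    {ρ : 𝒜 →⋆ₐ[ℂ] (H' →L[ℂ] H')} (hd : DisjointReps π ρ) (T : H →L[ℂ] H')
    (hT : ∀ A ξ, T (π A ξ) = ρ A (T ξ)) : T = 0 := by
  -- Polar decomposition without the partial isometry: `R = |T|` lies in the commutant of `π`, and
  -- `R ξ` and `T ξ` induce the same functional, hence equivalent cyclic subrepresentations.
  set P : H →L[ℂ] H := ContinuousLinearMap.adjoint T ∘L T with hP
  have hP0 : 0 ≤ P := (ContinuousLinearMap.nonneg_iff_isPositive _).2
    (ContinuousLinearMap.isPositive_adjoint_comp_self T)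
  have hcomm : ∀ A, Commute P (π A) := by
    intro A
    ext ξ
    refine ext_inner_left ℂ fun η => ?_
    simp only [hP, mul_apply_eq_comp, ContinuousLinearMap.comp_apply, hT]
    rw [ContinuousLinearMap.adjoint_inner_right, ← star_star A, ← rep_inner_left, ← hT,
      ← rep_inner_left, ContinuousLinearMap.adjoint_inner_right]
  set R := CFC.sqrt P with hR
  have hRR : R * R = P := CFC.sqrt_mul_sqrt_self P hP0
  have hRcomm : ∀ A, Commute R (π A) := fun A => (hcomm A).cfcₙ_nnreal _
  have hRsa : IsSelfAdjoint R := (CFC.sqrt_nonneg P).isSelfAdjoint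
  ext ξ
  have hfun : ∀ A, ⟪R ξ, π A (R ξ)⟫_ℂ = ⟪T ξ, ρ A (T ξ)⟫_ℂ := by
    intro A
    have h1 : π A (R ξ) = R (π A ξ) := by
      simpa using (DFunLike.congr_fun (hRcomm A).eq ξ).symm
    have h2 : ⟪R ξ, R (π A ξ)⟫_ℂ = ⟪ξ, (R * R) (π A ξ)⟫_ℂ := by
      have h3 : ContinuousLinearMap.adjoint R = R := hRsa
      rw [mul_apply_eq_comp,
        ← ContinuousLinearMap.adjoint_inner_left R (R (π A ξ)) ξ, h3]
    rw [h1, h2, hRR, hP, ContinuousLinearMap.comp_apply,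
      ContinuousLinearMap.adjoint_inner_right, hT]
  obtain ⟨U, -, hU⟩ := exists_cyclicSubspace_equiv π ρ (R ξ) (T ξ) hfun
  have hbot := hd _ _ (isSubrep_cyclicSubspace π (R ξ)) (isSubrep_cyclicSubspace ρ (T ξ)) U hU
  have hR0 : R ξ = 0 := by
    have := self_mem_cyclicSubspace π (R ξ)
    rwa [hbot, Submodule.mem_bot] at this
  have h0 := hfun 1
  rw [hR0, inner_zero_left, map_one, one_apply_eq_self, eq_comm, inner_self_eq_zero] at h0
  simpa using h0

/-- Two vectors of a representation which induce the same functional are related by a contraction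
in the commutant. -/
theorem exists_commutant_contraction (π : 𝒜 →⋆ₐ[ℂ] (H →L[ℂ] H)) (ξ η : H)
    (h : ∀ A, ⟪ξ, π A ξ⟫_ℂ = ⟪η, π A η⟫_ℂ) :
    ∃ V : H →L[ℂ] H, (∀ A ζ, V (π A ζ) = π A (V ζ)) ∧ (∀ ζ, ‖V ζ‖ ≤ ‖ζ‖) ∧ V ξ = η := by
  obtain ⟨U, hU₁, hU₂⟩ := exists_cyclicSubspace_equiv π π ξ η h
  let M := cyclicSubspace π ξ
  -- The cyclic subspace is invariant under a star-closed algebra, so its orthogonal complement is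
  -- too and the projection commutes with `π`. The required `V` is this projection followed by `U`.
  have hinv := (isSubrep_cyclicSubspace π ξ).2
  have hproj : ∀ A ζ, M.orthogonalProjectionOnto (π A ζ) =
      ⟨π A (M.orthogonalProjectionOnto ζ), hinv A _ (M.orthogonalProjectionOnto ζ).2⟩ := by
    intro A ζ
    refine Subtype.ext ?_
    change M.starProjection (π A ζ) = π A (M.starProjection ζ)
    refine (Submodule.eq_starProjection_of_mem_of_inner_eq_zero (hinv A _
      (M.orthogonalProjectionOnto ζ).2) fun m hm => ?_)
    change ⟪π A ζ - π A (M.starProjection ζ), m⟫_ℂ = 0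
    rw [← map_sub, rep_inner_left]
    exact M.starProjection_inner_eq_zero _ _ (hinv _ _ hm)
  refine ⟨(cyclicSubspace π η).subtypeL ∘L (U : M →L[ℂ] cyclicSubspace π η) ∘L
    M.orthogonalProjectionOnto, fun A ζ => ?_, fun ζ => ?_, ?_⟩
  · change (U (M.orthogonalProjectionOnto (π A ζ)) : H) =
      π A (U (M.orthogonalProjectionOnto ζ) : H)
    rw [hproj, hU₂]
  · change ‖U (M.orthogonalProjectionOnto ζ)‖ ≤ ‖ζ‖
    rw [U.norm_map]
    exact M.norm_orthogonalProjectionOnto_apply_le ζ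
  · change (U (M.orthogonalProjectionOnto ξ) : H) = η
    have h1 : M.orthogonalProjectionOnto ξ = cyclicOrbitMap π ξ 1 := by
      ext
      have := Submodule.starProjection_eq_self_iff.2 (self_mem_cyclicSubspace π ξ)
      simpa using this
    rw [h1, hU₁]
    simp

/-- The direct sum of two representations. -/
def prodRep (π : 𝒜 →⋆ₐ[ℂ] (H →L[ℂ] H)) (ρ : 𝒜 →⋆ₐ[ℂ] (H' →L[ℂ] H')) :
    𝒜 →⋆ₐ[ℂ] (WithLp 2 (H × H') →L[ℂ] WithLp 2 (H × H')) where
  toFun A := prodOp (π A) (ρ A)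
  map_one' := prodOp_ext (by simp) (by simp)
  map_mul' A B := prodOp_ext (fun ζ => DFunLike.congr_fun (map_mul π A B) ζ.fst)
    (fun ζ => DFunLike.congr_fun (map_mul ρ A B) ζ.snd)
  map_zero' := prodOp_ext (by simp) (by simp)
  map_add' A B := prodOp_ext (fun ζ => DFunLike.congr_fun (map_add π A B) ζ.fst)
    (fun ζ => DFunLike.congr_fun (map_add ρ A B) ζ.snd)
  commutes' c := prodOp_ext (by simp [Algebra.algebraMap_eq_smul_one])
    (by simp [Algebra.algebraMap_eq_smul_one])
  map_star' A := by
    rw [ContinuousLinearMap.star_eq_adjoint]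
    refine (ContinuousLinearMap.eq_adjoint_iff _ _).2 fun ζ χ => ?_
    change ⟪π (star A) ζ.fst, χ.fst⟫_ℂ + ⟪ρ (star A) ζ.snd, χ.snd⟫_ℂ =
      ⟪ζ.fst, π A χ.fst⟫_ℂ + ⟪ζ.snd, ρ A χ.snd⟫_ℂ
    rw [rep_inner_left, rep_inner_left, star_star]

theorem prodRep_apply (π : 𝒜 →⋆ₐ[ℂ] (H →L[ℂ] H)) (ρ : 𝒜 →⋆ₐ[ℂ] (H' →L[ℂ] H')) (A : 𝒜)
    (ζ : WithLp 2 (H × H')) :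
    prodRep π ρ A ζ = WithLp.toLp 2 (π A ζ.fst, ρ A ζ.snd) := rfl

end Representations

/-! ### Separation of vectors of disjoint representations. -/

section Separation

variable {𝒜 : Type u} [CStarAlgebra 𝒜]
  {H : Type v} [NormedAddCommGroup H] [InnerProductSpace ℂ H] [CompleteSpace H]
  {H' : Type w} [NormedAddCommGroup H'] [InnerProductSpace ℂ H'] [CompleteSpace H']

/-- The difference of the two sides is twice `⟪ζ, π A ξ⟫ + ⟪ξ, π A ζ⟫`. For self-adjoint `A` this
sum is `2 Re ⟪ζ, π A ξ⟫ = 0`; the general case uses `A + A*` and `i(A - A*)`. -/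
theorem inner_rep_add_self_eq_sub_self (π : 𝒜 →⋆ₐ[ℂ] (H →L[ℂ] H)) (ξ ζ : H)
    (h : ∀ A, IsSelfAdjoint A → (⟪ζ, π A ξ⟫_ℂ).re = 0) (A : 𝒜) :
    ⟪ξ + ζ, π A (ξ + ζ)⟫_ℂ = ⟪ξ - ζ, π A (ξ - ζ)⟫_ℂ := by
  have hconj : ⟪ξ, π A ζ⟫_ℂ = (starRingEnd ℂ) ⟪ζ, π (star A) ξ⟫_ℂ := by
    rw [inner_conj_symm, rep_inner_left, star_star]
  have h1 := h (A + star A) (IsSelfAdjoint.add_star_self A)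
  have h2 := h (Complex.I • (A - star A)) (by
    rw [isSelfAdjoint_iff, star_smul, star_sub, star_star, Complex.star_def, Complex.conj_I,
      neg_smul, ← smul_neg, neg_sub])
  simp only [map_add, map_sub, map_smul, add_apply, sub_apply, smul_apply, inner_add_right,
    inner_sub_right, inner_smul_right, Complex.add_re, Complex.mul_re, Complex.I_re, Complex.I_im,
    Complex.sub_im, Complex.sub_re, zero_mul, one_mul, zero_sub] at h1 h2
  have h3 : ⟪ζ, π A ξ⟫_ℂ + ⟪ξ, π A ζ⟫_ℂ = 0 := by
    rw [hconj]
    apply Complex.ext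
    · simpa only [Complex.add_re, Complex.conj_re, Complex.zero_re] using h1
    · simp only [Complex.add_im, Complex.conj_im, Complex.zero_im]
      linarith
  simp only [map_add, map_sub, inner_add_right, inner_add_left, inner_sub_left, inner_sub_right]
  linear_combination 2 * h3

/-- A real continuous linear functional on the direct sum of two disjoint representations which
vanishes on the orbit of `(ξ, η)` under the self-adjoint elements vanishes on `(0, η)`. -/
theorem DisjointReps.re_inner_nonpos {π : 𝒜 →⋆ₐ[ℂ] (H →L[ℂ] H)}
    {ρ : 𝒜 →⋆ₐ[ℂ] (H' →L[ℂ] H')} (hd : DisjointReps π ρ) (χ ζ : WithLp 2 (H × H'))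
    (h : ∀ A, IsSelfAdjoint A → (⟪ζ, prodRep π ρ A χ⟫_ℂ).re = 0) :
    (⟪ζ.snd, χ.snd⟫_ℂ).re ≤ 0 := by
  obtain ⟨V, hV, hVn, hVχ⟩ := exists_commutant_contraction (prodRep π ρ) (χ - ζ) (χ + ζ)
    fun A => (inner_rep_add_self_eq_sub_self _ χ ζ h A).symm
  let inl : H →L[ℂ] WithLp 2 (H × H') :=
    (WithLp.prodContinuousLinearEquiv 2 ℂ H H').symm.toContinuousLinearMap ∘L
      ContinuousLinearMap.inl ℂ H H'
  have hinl : ∀ A a, inl (π A a) = prodRep π ρ A (inl a) := fun A a =>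
    WithLp.ofLp_injective 2 (Prod.ext rfl (map_zero (ρ A)).symm)
  -- The block of `V` from `H` to `H'` is an intertwiner, hence zero; the second component of `V (χ
  -- - ζ)` therefore depends only on that of `χ - ζ`.
  have hT := hd.intertwiner_eq_zero (WithLp.sndL 2 ℂ H H' ∘L V ∘L inl) fun A a => by
    change (V (inl (π A a))).snd = ρ A (V (inl a)).snd
    rw [hinl, hV]
    rfl
  have hsplit : χ - ζ = inl (χ - ζ).fst + WithLp.toLp 2 (0, (χ - ζ).snd) :=
    WithLp.ofLp_injective 2 (Prod.ext (add_zero _).symm (zero_add _).symm)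
  have hle : ‖χ.snd + ζ.snd‖ ≤ ‖χ.snd - ζ.snd‖ := by
    calc ‖χ.snd + ζ.snd‖ = ‖(V (χ - ζ)).snd‖ := by rw [hVχ]; rfl
      _ = ‖(V (WithLp.toLp 2 (0, (χ - ζ).snd))).snd‖ := by
        have h0 : (V (inl (χ - ζ).fst)).snd = 0 := DFunLike.congr_fun hT (χ - ζ).fst
        conv_lhs => rw [hsplit, map_add, WithLp.add_snd, h0, zero_add]
      _ ≤ ‖V (WithLp.toLp 2 (0, (χ - ζ).snd))‖ := WithLp.norm_snd_le _ _
      _ ≤ ‖(WithLp.toLp 2 (0, (χ - ζ).snd) : WithLp 2 (H × H'))‖ := hVn _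
      _ = ‖χ.snd - ζ.snd‖ := by simp
  have h1 := norm_add_sq (𝕜 := ℂ) χ.snd ζ.snd
  have h2 := norm_sub_sq (𝕜 := ℂ) χ.snd ζ.snd
  have h3 := pow_le_pow_left₀ (norm_nonneg _) hle 2
  rw [← inner_conj_symm, Complex.conj_re]
  simp only [RCLike.re_to_complex] at h1 h2
  linarith

/-- Hahn–Banach is applied to the real subspace of self-adjoint orbit vectors, so that the
approximating element is itself self-adjoint and admits a real functional calculus. -/
theorem DisjointReps.exists_isSelfAdjoint {π : 𝒜 →⋆ₐ[ℂ] (H →L[ℂ] H)}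
    {ρ : 𝒜 →⋆ₐ[ℂ] (H' →L[ℂ] H')} (hd : DisjointReps π ρ) (ξ : H) (η : H') {ε : ℝ} (hε : 0 < ε) :
    ∃ A : 𝒜, IsSelfAdjoint A ∧ ‖π A ξ‖ ≤ ε ∧ ‖ρ A η - η‖ ≤ ε := by
  let χ : WithLp 2 (H × H') := WithLp.toLp 2 (ξ, η)
  let S : Set (WithLp 2 (H × H')) := (fun A => prodRep π ρ A χ) '' {A | IsSelfAdjoint A}
  have hconv : Convex ℝ S := by
    rintro _ ⟨A, hA, rfl⟩ _ ⟨B, hB, rfl⟩ s t - - -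
    refine ⟨s • A + t • B, ((IsSelfAdjoint.all s).smul hA).add ((IsSelfAdjoint.all t).smul hB), ?_⟩
    dsimp only
    rw [map_add, ← Complex.coe_smul s A, ← Complex.coe_smul t B, map_smul, map_smul, add_apply,
      smul_apply, smul_apply, Complex.coe_smul, Complex.coe_smul]
  have hmem : (WithLp.toLp 2 (0, η) : WithLp 2 (H × H')) ∈ closure S := by
    by_contra hnot
    obtain ⟨f, c, hfc, hcf⟩ := RCLike.geometric_hahn_banach_closed_point (𝕜 := ℂ)
      hconv.closure isClosed_closure hnot
    let ζ := (InnerProductSpace.toDual ℂ (WithLp 2 (H × H'))).symm f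
    have hζ : ∀ a, ⟪ζ, a⟫_ℂ = f a := fun a => InnerProductSpace.toDual_symm_apply
    have hc : 0 < c := by
      simpa using hfc 0 (subset_closure ⟨0, IsSelfAdjoint.zero _, by simp⟩)
    have hzero : ∀ A, IsSelfAdjoint A → (⟪ζ, prodRep π ρ A χ⟫_ℂ).re = 0 := by
      intro A hA
      by_contra hne
      -- A nonzero value could be rescaled to equal `c`, against the strict bound on `S`.
      have := hfc _ (subset_closure ⟨((c / (⟪ζ, prodRep π ρ A χ⟫_ℂ).re : ℝ)) • A,
        (IsSelfAdjoint.all _).smul hA, rfl⟩)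
      rw [← hζ] at this
      dsimp only at this
      rw [← Complex.coe_smul, map_smul, smul_apply, inner_smul_right, RCLike.re_to_complex,
        Complex.re_ofReal_mul, div_mul_cancel₀ _ hne] at this
      exact lt_irrefl _ this
    have h1 := hd.re_inner_nonpos χ ζ hzero
    have h2 : ⟪ζ, (WithLp.toLp 2 (0, η) : WithLp 2 (H × H'))⟫_ℂ = ⟪ζ.snd, χ.snd⟫_ℂ := by
      change ⟪ζ.fst, (0 : H)⟫_ℂ + ⟪ζ.snd, η⟫_ℂ = _
      rw [inner_zero_right, zero_add]
      rfl
    rw [← hζ, h2, RCLike.re_to_complex] at hcf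
    linarith
  obtain ⟨_, ⟨A, hA, rfl⟩, hdist⟩ := Metric.mem_closure_iff.1 hmem ε hε
  rw [dist_comm, dist_eq_norm] at hdist
  refine ⟨A, hA, ?_, ?_⟩
  · have := (WithLp.norm_fst_le _ (prodRep π ρ A χ - WithLp.toLp 2 (0, η))).trans hdist.le
    simpa [prodRep_apply, χ] using this
  · exact (WithLp.norm_snd_le _ (prodRep π ρ A χ - WithLp.toLp 2 (0, η))).trans hdist.le

/-- With `h = √(g² - f²)`, the squared norm for `g` is the sum of those for `f` and `h`. This lets
estimates at a fixed vector survive a cutoff. -/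
theorem norm_rep_cfc_le (π : 𝒜 →⋆ₐ[ℂ] (H →L[ℂ] H)) {X : 𝒜} (hX : IsSelfAdjoint X)
    {f g : ℝ → ℝ} (hf : Continuous f) (hg : Continuous g) (hfg : ∀ t, |f t| ≤ |g t|) (ξ : H) :
    ‖π (cfc f X) ξ‖ ≤ ‖π (cfc g X) ξ‖ := by
  have hsq : ∀ k : ℝ → ℝ, Continuous k →
      ‖π (cfc k X) ξ‖ ^ 2 = (⟪ξ, π (cfc (fun t => k t ^ 2) X) ξ⟫_ℂ).re := by
    intro k hk
    rw [← Complex.ofReal_re (‖π (cfc k X) ξ‖ ^ 2), rep_norm_sq,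
      (IsSelfAdjoint.cfc (f := k) (a := X)).star_eq,
      cfc_pow k 2 X hk.continuousOn, sq]
  let h : ℝ → ℝ := fun t => √(g t ^ 2 - f t ^ 2)
  have hh : Continuous h := by fun_prop
  have hdecomp : cfc (fun t => g t ^ 2) X =
      cfc (fun t => f t ^ 2) X + cfc (fun t => h t ^ 2) X := by
    rw [← cfc_add X _ _ (by fun_prop) (by fun_prop)]
    congr 1
    funext t
    rw [Real.sq_sqrt (sub_nonneg.2 (sq_le_sq.2 (hfg t)))]
    ring
  refine (sq_le_sq₀ (norm_nonneg _) (norm_nonneg _)).1 ?_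
  rw [hsq f hf, hsq g hg, hdecomp, map_add, add_apply, inner_add_right, Complex.add_re, ← hsq h hh]
  linarith [sq_nonneg ‖π (cfc h X) ξ‖]

theorem abs_clip_sub_le (s t : ℝ) :
    |max (-1) (min s 1) - max (-1) (min t 1)| ≤ |s - t| := by
  refine (abs_max_sub_max_le_max _ _ _ _).trans (max_le (by simp) ?_)
  exact (abs_min_sub_min_le_max _ _ _ _).trans (max_le le_rfl (by simp))

/-- Vectors of disjoint representations are separated by a self-adjoint contraction. -/
theorem DisjointReps.exists_contraction {π : 𝒜 →⋆ₐ[ℂ] (H →L[ℂ] H)}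
    {ρ : 𝒜 →⋆ₐ[ℂ] (H' →L[ℂ] H')} (hd : DisjointReps π ρ) (ξ : H) (η : H') {ε : ℝ} (hε : 0 < ε) :
    ∃ D : 𝒜, IsSelfAdjoint D ∧ ‖D‖ ≤ 1 ∧ ‖π D ξ + ξ‖ ≤ ε ∧ ‖ρ D η - η‖ ≤ ε := by
  obtain ⟨A, hA, hA₁, hA₂⟩ := hd.exists_isSelfAdjoint ξ η (half_pos hε)
  -- `A` acts nearly as `0` on `ξ` and as `1` on `η`, so `X` acts nearly as `-1` and `1`. The clip
  -- `f` is 1-Lipschitz and fixes `±1`, so it does not worsen these errors; the factor `2` is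
  -- absorbed by `ε / 2`.
  set X : 𝒜 := (2 : ℝ) • A - 1 with hXdef
  have hX : IsSelfAdjoint X := ((IsSelfAdjoint.all _).smul hA).sub (IsSelfAdjoint.one _)
  let f : ℝ → ℝ := fun t => max (-1) (min t 1)
  have hf : Continuous f := by fun_prop
  have hplus : ∀ k : ℝ → ℝ, Continuous k → cfc (fun t => k t + 1) X = cfc k X + 1 := by
    intro k hk
    rw [cfc_add X k (fun _ => 1) hk.continuousOn (by fun_prop), cfc_const_one ℝ X]
  have hminus : ∀ k : ℝ → ℝ, Continuous k → cfc (fun t => k t - 1) X = cfc k X - 1 := by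
    intro k hk
    rw [cfc_sub k (fun _ => 1) X hk.continuousOn (by fun_prop), cfc_const_one ℝ X]
  have hπ : ∀ ζ, π X ζ + ζ = (2 : ℝ) • π A ζ := fun ζ => by
    rw [hXdef, map_sub, ← Complex.coe_smul, map_smul, map_one, sub_apply, smul_apply,
      Complex.coe_smul, one_apply_eq_self, sub_add_cancel]
  have hρ : ∀ ζ, ρ X ζ - ζ = (2 : ℝ) • (ρ A ζ - ζ) := fun ζ => by
    rw [hXdef, map_sub, ← Complex.coe_smul, map_smul, map_one, sub_apply, smul_apply,
      Complex.coe_smul, one_apply_eq_self, smul_sub, two_smul ℝ ζ, sub_sub]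
  refine ⟨cfc f X, IsSelfAdjoint.cfc, norm_cfc_le zero_le_one fun t _ => ?_, ?_, ?_⟩
  · exact abs_le.2 ⟨le_max_left _ _, max_le (by norm_num) (min_le_right _ _)⟩
  · have h := norm_rep_cfc_le π hX (f := fun t => f t + 1) (g := fun t => id t + 1)
      (by fun_prop) (by fun_prop) (fun t => ?_) ξ
    · rw [hplus f hf, hplus id continuous_id, cfc_id ℝ X, map_add, map_add, add_apply, add_apply,
        map_one, one_apply_eq_self, hπ, norm_smul, Real.norm_two] at h
      linarith
    · simpa [f] using abs_clip_sub_le t (-1)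
  · have h := norm_rep_cfc_le ρ hX (f := fun t => f t - 1) (g := fun t => id t - 1)
      (by fun_prop) (by fun_prop) (fun t => ?_) η
    · rw [hminus f hf, hminus id continuous_id, cfc_id ℝ X, map_sub, map_sub, sub_apply, sub_apply,
        map_one, one_apply_eq_self, hρ, norm_smul, Real.norm_two] at h
      linarith
    · simpa [f] using abs_clip_sub_le t 1

end Separation

/-! ### Local perturbations as vector states in the GNS space. -/

section GNS

variable {𝒜 : Type u} [CStarAlgebra 𝒜] [PartialOrder 𝒜] [StarOrderedRing 𝒜]

/-- The cyclic vector of the GNS representation. -/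
def State.gnsVector (ω : State 𝒜) : ω.GNSSpace := ((ω.1.toPreGNS 1 : ω.1.PreGNS) : ω.1.GNS)

theorem State.inner_gnsVector (ω : State 𝒜) (A : 𝒜) :
    ⟪ω.gnsVector, ω.gnsRep A ω.gnsVector⟫_ℂ = ω A := by
  have h : ω.gnsRep A ω.gnsVector = ((ω.1.toPreGNS A : ω.1.PreGNS) : ω.1.GNS) := by
    change ω.1.gnsNonUnitalStarAlgHom A ((ω.1.toPreGNS 1 : ω.1.PreGNS) : ω.1.GNS) = _
    rw [PositiveLinearMap.gnsNonUnitalStarAlgHom_apply_coe]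
    simp
  rw [h, State.gnsVector, UniformSpace.Completion.inner_coe, PositiveLinearMap.preGNS_inner_def]
  simp

theorem State.norm_gnsVector (ω : State 𝒜) : ‖ω.gnsVector‖ = 1 := by
  have h := ω.inner_gnsVector 1
  rw [map_one, one_apply_eq_self, inner_self_eq_norm_sq_to_K] at h
  have h2 : ‖ω.gnsVector‖ ^ 2 = 1 := by
    have h1 : ω 1 = 1 := ω.2
    rw [h1] at h
    exact Complex.ofReal_injective (by simpa using h)
  exact (pow_eq_one_iff_of_nonneg (norm_nonneg _) two_ne_zero).1 h2

theorem State.norm_sq_gnsRep (ω : State 𝒜) (A : 𝒜) :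
    ((‖ω.gnsRep A ω.gnsVector‖ ^ 2 : ℝ) : ℂ) = ω (star A * A) := by
  rw [rep_norm_sq, ω.inner_gnsVector]

/-- The normalized vector of the GNS space which induces a local perturbation. -/
def State.perturbVector (ω : State 𝒜) (A : 𝒜) : ω.GNSSpace :=
  ((‖ω.gnsRep A ω.gnsVector‖⁻¹ : ℝ) : ℂ) • ω.gnsRep A ω.gnsVector

theorem State.inner_perturbVector (ω : State 𝒜) (A : 𝒜) (hA : ω (star A * A) ≠ 0) (B : 𝒜) :
    ⟪ω.perturbVector A, ω.gnsRep B (ω.perturbVector A)⟫_ℂ = ω.perturb A hA B := by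
  have h : ⟪ω.gnsRep A ω.gnsVector, ω.gnsRep B (ω.gnsRep A ω.gnsVector)⟫_ℂ =
      ω (star A * B * A) := by
    rw [rep_inner_left, ← mul_apply_eq_comp, ← mul_apply_eq_comp, ← map_mul, ← map_mul,
      ω.inner_gnsVector, mul_assoc]
  rw [State.perturbVector, map_smul, inner_smul_left, inner_smul_right, h, State.perturb_apply,
    ← State.norm_sq_gnsRep, Complex.conj_ofReal]
  push_cast
  ring

theorem State.norm_perturbVector (ω : State 𝒜) (A : 𝒜) (hA : ω (star A * A) ≠ 0) :
    ‖ω.perturbVector A‖ = 1 := by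
  have h : ‖ω.gnsRep A ω.gnsVector‖ ≠ 0 := fun h0 => hA (by rw [← State.norm_sq_gnsRep, h0]; simp)
  rw [State.perturbVector, norm_smul, Complex.norm_real, norm_inv, norm_norm, inv_mul_cancel₀ h]

/-- The perturbed state is induced by a unit vector of the GNS space of `ω`, whose nonzero cyclic
subspace is equivalent to a subrepresentation of the GNS representation of the perturbation. -/
theorem State.coherentStates_perturb (ω : State 𝒜) (A : 𝒜) (hA : ω (star A * A) ≠ 0) :
    CoherentStates ω (ω.perturb A hA) := by
  intro hd
  obtain ⟨U, -, hU⟩ := exists_cyclicSubspace_equiv ω.gnsRep (ω.perturb A hA).gnsRep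
    (ω.perturbVector A) (ω.perturb A hA).gnsVector fun B => by
      rw [ω.inner_perturbVector A hA, State.inner_gnsVector]
  have hbot := hd _ _ (isSubrep_cyclicSubspace _ _) (isSubrep_cyclicSubspace _ _) U hU
  have h0 := self_mem_cyclicSubspace ω.gnsRep (ω.perturbVector A)
  rw [hbot, Submodule.mem_bot] at h0
  have h1 := ω.norm_perturbVector A hA
  rw [h0, norm_zero] at h1
  exact zero_ne_one h1

theorem State.perturb_mem_folium (ω : State 𝒜) (A : 𝒜) (hA : ω (star A * A) ≠ 0) :
    ω.perturb A hA ∈ folium ω :=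
  fun _ hF hω => hF.perturb_mem ω hω A hA

/-- A state and a local perturbation of a state disjoint from it have maximal norm distance. -/
theorem DisjointStates.exists_contraction_perturb {ω₁ ω₂ : State 𝒜} (hd : DisjointStates ω₁ ω₂)
    (A : 𝒜) (hA : ω₂ (star A * A) ≠ 0) {ε : ℝ} (hε : 0 < ε) :
    ∃ D : 𝒜, ‖D‖ ≤ 1 ∧ ‖ω₁ D + 1‖ ≤ ε ∧ ‖ω₂.perturb A hA D - 1‖ ≤ ε := by
  obtain ⟨D, -, hD, h₁, h₂⟩ :=
    DisjointReps.exists_contraction hd ω₁.gnsVector (ω₂.perturbVector A) hε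
  refine ⟨D, hD, ?_, ?_⟩
  · have h : ω₁ D + 1 = ⟪ω₁.gnsVector, ω₁.gnsRep D ω₁.gnsVector + ω₁.gnsVector⟫_ℂ := by
      rw [inner_add_right, ω₁.inner_gnsVector, inner_self_eq_norm_sq_to_K, ω₁.norm_gnsVector]
      simp
    rw [h]
    refine (norm_inner_le_norm _ _).trans ?_
    rwa [ω₁.norm_gnsVector, one_mul]
  · have h : ω₂.perturb A hA D - 1 = ⟪ω₂.perturbVector A,
        ω₂.gnsRep D (ω₂.perturbVector A) - ω₂.perturbVector A⟫_ℂ := by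
      rw [inner_sub_right, ω₂.inner_perturbVector A hA, inner_self_eq_norm_sq_to_K,
        ω₂.norm_perturbVector A hA]
      simp
    rw [h]
    refine (norm_inner_le_norm _ _).trans ?_
    rwa [ω₂.norm_perturbVector A hA, one_mul]

end GNS

namespace QuasilocalAlgebra

/-! ### Restrictions to finite subsystems and the norm distance of vector states. -/

section Restrictions

variable {𝒜 : Type u} [CStarAlgebra 𝒜] {H : ℕ → Type v} [∀ k, NormedAddCommGroup (H k)]
  [∀ k, InnerProductSpace ℂ (H k)] [∀ k, CompleteSpace (H k)] {Q : QuasilocalAlgebra 𝒜 H}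

theorem isRestriction_iff {A : 𝒜} {a : ∀ k, Q.loc k} :
    Q.IsRestriction A a ↔ Tendsto (fun k => (a k : 𝒜)) atTop (𝓝 A) := by
  rw [tendsto_iff_norm_sub_tendsto_zero, IsRestriction]
  simp only [norm_sub_rev A]

theorem IsRestriction.star {A : 𝒜} {a : ∀ k, Q.loc k} (ha : Q.IsRestriction A a) :
    Q.IsRestriction (star A) fun k => star (a k) :=
  isRestriction_iff.2 (Filter.Tendsto.star (isRestriction_iff.1 ha))

theorem IsRestriction.mul {A B : 𝒜} {a b : ∀ k, Q.loc k} (ha : Q.IsRestriction A a)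
    (hb : Q.IsRestriction B b) : Q.IsRestriction (A * B) fun k => a k * b k :=
  isRestriction_iff.2 ((isRestriction_iff.1 ha).mul (isRestriction_iff.1 hb))

theorem IsRestriction.add {A B : 𝒜} {a b : ∀ k, Q.loc k} (ha : Q.IsRestriction A a)
    (hb : Q.IsRestriction B b) : Q.IsRestriction (A + B) fun k => a k + b k :=
  isRestriction_iff.2 ((isRestriction_iff.1 ha).add (isRestriction_iff.1 hb))

theorem IsRestriction.sub {A B : 𝒜} {a b : ∀ k, Q.loc k} (ha : Q.IsRestriction A a)
    (hb : Q.IsRestriction B b) : Q.IsRestriction (A - B) fun k => a k - b k :=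
  isRestriction_iff.2 ((isRestriction_iff.1 ha).sub (isRestriction_iff.1 hb))

theorem isRestriction_one : Q.IsRestriction (1 : 𝒜) fun _ => 1 :=
  isRestriction_iff.2 tendsto_const_nhds

theorem exists_isRestriction_contraction (Q : QuasilocalAlgebra 𝒜 H) {A : 𝒜} (hA : ‖A‖ ≤ 1) :
    ∃ a : ∀ k, Q.loc k, Q.IsRestriction A a ∧ ∀ k, ‖a k‖ ≤ 1 := by
  obtain ⟨a, ha⟩ := Q.exists_isRestriction A
  have ha' := isRestriction_iff.1 ha
  -- Dividing by `max 1 ‖a k‖` enforces the bound; the factor tends to `1` because `‖A‖ ≤ 1`.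
  refine ⟨fun k => (((max 1 ‖a k‖)⁻¹ : ℝ) : ℂ) • a k, isRestriction_iff.2 ?_, fun k => ?_⟩
  · have h1 : Tendsto (fun k => ((max 1 ‖a k‖)⁻¹ : ℝ)) atTop (𝓝 1) := by
      have := (tendsto_const_nhds (x := (1 : ℝ))).max ha'.norm
      rw [max_eq_left hA] at this
      simpa using this.inv₀ one_ne_zero
    have h2 := ((Complex.continuous_ofReal.tendsto 1).comp h1).smul ha'
    simpa using h2
  · have hpos : 0 < max 1 ‖a k‖ := lt_max_of_lt_left one_pos
    rw [norm_smul, Complex.norm_real, Real.norm_of_nonneg (inv_nonneg.2 hpos.le),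
      inv_mul_le_iff₀ hpos, mul_one]
    exact le_max_right _ _

theorem norm_rep_le (Q : QuasilocalAlgebra 𝒜 H) (k : ℕ) (a : Q.loc k) : ‖Q.rep k a‖ ≤ ‖a‖ := by
  -- Closedness makes the local algebra a C*-algebra, on which star homomorphisms are contractive.
  have := Q.isClosed_loc k
  exact NonUnitalStarAlgHom.norm_apply_le (Q.rep k) a

theorem norm_vectorFunctional_le (Q : QuasilocalAlgebra 𝒜 H) (k : ℕ) {ξ : H k} (hξ : ‖ξ‖ = 1)
    (a : Q.loc k) : ‖Q.vectorFunctional k ξ a‖ ≤ ‖a‖ := by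
  refine (norm_inner_le_norm _ _).trans ?_
  rw [hξ, one_mul]
  refine ((Q.rep k a).le_opNorm ξ).trans ?_
  rw [hξ, mul_one]
  exact Q.norm_rep_le k a

theorem norm_vectorFunctional_sub_le (Q : QuasilocalAlgebra 𝒜 H) (k : ℕ) {ξ η : H k}
    (hξ : ‖ξ‖ = 1) (hη : ‖η‖ = 1) {a : Q.loc k} (ha : ‖a‖ ≤ 1) :
    ‖Q.vectorFunctional k ξ a - Q.vectorFunctional k η a‖ ≤ 2 := by
  refine (norm_sub_le _ _).trans ?_
  linarith [Q.norm_vectorFunctional_le k hξ a, Q.norm_vectorFunctional_le k hη a]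

theorem vectorDist_le_two (Q : QuasilocalAlgebra 𝒜 H) (k : ℕ) {ξ η : H k} (hξ : ‖ξ‖ = 1)
    (hη : ‖η‖ = 1) : Q.vectorDist k ξ η ≤ 2 :=
  Real.iSup_le (fun a => Q.norm_vectorFunctional_sub_le k hξ hη a.2) zero_le_two

theorem le_vectorDist (Q : QuasilocalAlgebra 𝒜 H) (k : ℕ) {ξ η : H k} (hξ : ‖ξ‖ = 1)
    (hη : ‖η‖ = 1) {a : Q.loc k} (ha : ‖a‖ ≤ 1) :
    ‖Q.vectorFunctional k ξ a - Q.vectorFunctional k η a‖ ≤ Q.vectorDist k ξ η :=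
  le_ciSup (f := fun a : {a : Q.loc k // ‖a‖ ≤ 1} =>
      ‖Q.vectorFunctional k ξ a - Q.vectorFunctional k η a‖)
    ⟨2, by rintro _ ⟨b, rfl⟩; exact Q.norm_vectorFunctional_sub_le k hξ hη b.2⟩ ⟨a, ha⟩

theorem vectorFunctional_star_mul_self (Q : QuasilocalAlgebra 𝒜 H) (k : ℕ) (ξ : H k)
    (a : Q.loc k) :
    Q.vectorFunctional k ξ (star a * a) = ((‖Q.rep k a ξ‖ ^ 2 : ℝ) : ℂ) :=
  (rep_norm_sq (Q.rep k) a ξ).symm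

/-- The transition probability vanishes between states of maximal norm distance. -/
theorem WeakStarTendsto.hasTransitionProbability_zero [PartialOrder 𝒜] {x y : ∀ k, H k}
    {ω₁ ω₂ : State 𝒜} (hx : Q.WeakStarTendsto x ω₁) (hy : Q.WeakStarTendsto y ω₂)
    (hsep : ∀ ε : ℝ, 0 < ε → ∃ D : 𝒜, ‖D‖ ≤ 1 ∧ ‖ω₁ D + 1‖ ≤ ε ∧ ‖ω₂ D - 1‖ ≤ ε) :
    Q.HasTransitionProbability x y ω₁ ω₂ 0 := by
  refine ⟨hx, hy, ?_⟩
  have hlim : Tendsto (fun k => Q.vectorDist k (x k) (y k)) atTop (𝓝 2) := by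
    refine tendsto_order.2 ⟨fun c hc => ?_, fun c hc => ?_⟩
    · obtain ⟨D, hD, h₁, h₂⟩ := hsep ((2 - c) / 4) (by linarith)
      obtain ⟨d, hd, hd1⟩ := Q.exists_isRestriction_contraction hD
      have hlow : c < ‖ω₁ D - ω₂ D‖ := by
        have h3 : (2 : ℂ) = (ω₁ D + 1) - (ω₂ D - 1) - (ω₁ D - ω₂ D) := by ring
        have h4 : (2 : ℝ) ≤ ‖ω₁ D + 1‖ + ‖ω₂ D - 1‖ + ‖ω₁ D - ω₂ D‖ := by
          calc (2 : ℝ) = ‖(2 : ℂ)‖ := by simp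
            _ = ‖(ω₁ D + 1) - (ω₂ D - 1) - (ω₁ D - ω₂ D)‖ := by rw [← h3]
            _ ≤ _ := (norm_sub_le _ _).trans (add_le_add_left (norm_sub_le _ _) _)
        linarith
      filter_upwards [((hx.tendsto D d hd).sub (hy.tendsto D d hd)).norm.eventually_const_lt hlow,
        hx.norm_eq_one, hy.norm_eq_one] with k hk hxk hyk
      exact hk.trans_le (Q.le_vectorDist k hxk hyk (hd1 k))
    · filter_upwards [hx.norm_eq_one, hy.norm_eq_one] with k hxk hyk
      exact (Q.vectorDist_le_two k hxk hyk).trans_lt hc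
  have h := ((hlim.pow 2).const_mul (1 / 4 : ℝ)).const_sub 1
  norm_num at h
  simpa using h

end Restrictions

/-! ### Limits of perturbed vector states and of interference terms. -/

section Limits

variable {𝒜 : Type u} [CStarAlgebra 𝒜] [PartialOrder 𝒜] [StarOrderedRing 𝒜]
  {H : ℕ → Type v} [∀ k, NormedAddCommGroup (H k)] [∀ k, InnerProductSpace ℂ (H k)]
  [∀ k, CompleteSpace (H k)] {Q : QuasilocalAlgebra 𝒜 H} {x y : ∀ k, H k} {ω₁ ω₂ ω : State 𝒜}

/-- The squared norms are expectations of `A* A`, so weak* convergence transfers norm estimates from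
the GNS space to the finite systems. -/
theorem WeakStarTendsto.tendsto_norm_rep (hx : Q.WeakStarTendsto x ω) {A : 𝒜}
    {a : ∀ k, Q.loc k} (ha : Q.IsRestriction A a) :
    Tendsto (fun k => ‖Q.rep k (a k) (x k)‖) atTop (𝓝 ‖ω.gnsRep A ω.gnsVector‖) := by
  have h := hx.tendsto _ _ (ha.star.mul ha)
  simp only [vectorFunctional_star_mul_self] at h
  rw [← ω.norm_sq_gnsRep] at h
  have h1 := ((Complex.continuous_re.tendsto _).comp h).sqrt
  simpa [Function.comp_def, ← Complex.ofReal_pow] using h1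

theorem WeakStarTendsto.perturbVec (hx : Q.WeakStarTendsto x ω) {A : 𝒜}
    (hA : ω (star A * A) ≠ 0) {a : ∀ k, Q.loc k} (ha : Q.IsRestriction A a) :
    Q.WeakStarTendsto (Q.perturbVec a x) (ω.perturb A hA) := by
  have hn := hx.tendsto_norm_rep ha
  have hne : ‖ω.gnsRep A ω.gnsVector‖ ≠ 0 := fun h0 => hA (by rw [← ω.norm_sq_gnsRep, h0]; simp)
  refine ⟨?_, fun B b hb => ?_⟩
  · filter_upwards [hn.eventually_ne hne] with k hk
    rw [QuasilocalAlgebra.perturbVec, norm_smul, Complex.norm_real, norm_inv, norm_norm,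
      inv_mul_cancel₀ hk]
  · have h1 := hx.tendsto _ _ ((ha.star.mul hb).mul ha)
    have h2 := hx.tendsto _ _ (ha.star.mul ha)
    refine (h1.div h2 hA).congr fun k => ?_
    rw [Pi.div_apply, vectorFunctional_star_mul_self]
    have h3 : Q.vectorFunctional k (x k) (star (a k) * b k * a k) =
        ⟪Q.rep k (a k) (x k), Q.rep k (b k) (Q.rep k (a k) (x k))⟫_ℂ := by
      rw [rep_inner_left, vectorFunctional, mul_assoc, map_mul, map_mul]
      rfl
    rw [h3, vectorFunctional, QuasilocalAlgebra.perturbVec, map_smul, inner_smul_left,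
      inner_smul_right, Complex.conj_ofReal]
    push_cast
    ring

/-- Interference terms between sequences of vectors with disjoint limit states vanish in the
limit. -/
theorem WeakStarTendsto.tendsto_inner_rep_zero (hx : Q.WeakStarTendsto x ω₁)
    (hy : Q.WeakStarTendsto y ω₂) (hd : DisjointStates ω₁ ω₂) {A : 𝒜} {a : ∀ k, Q.loc k}
    (ha : Q.IsRestriction A a) :
    Tendsto (fun k => ⟪x k, Q.rep k (a k) (y k)⟫_ℂ) atTop (𝓝 0) := by
  refine tendsto_zero_iff_norm_tendsto_zero.2 (tendsto_order.2
    ⟨fun c hc => Eventually.of_forall fun k => hc.trans_le (norm_nonneg _), fun c hc => ?_⟩)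
  set η := ω₂.gnsRep A ω₂.gnsVector with hη
  -- The tolerance makes the limiting error `ε ‖η‖ + ε` equal to `c`; the denominator is positive
  -- even when `η = 0`, so `ω₂(A* A) = 0` is covered.
  obtain ⟨D, hDsa, -, h₁, h₂⟩ := DisjointReps.exists_contraction hd ω₁.gnsVector η
    (ε := c / (‖η‖ + 1)) (by positivity)
  obtain ⟨d, hdD⟩ := Q.exists_isRestriction D
  have hplus := hx.tendsto_norm_rep (isRestriction_one.add hdD.star)
  have hminus := hy.tendsto_norm_rep ((isRestriction_one.sub hdD).mul ha)
  have hlim := (hplus.mul (hy.tendsto_norm_rep ha)).add hminus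
  have hbound : ‖ω₁.gnsRep (1 + star D) ω₁.gnsVector‖ * ‖η‖ +
      ‖ω₂.gnsRep ((1 - D) * A) ω₂.gnsVector‖ < 2 * c := by
    have e₁ : ω₁.gnsRep (1 + star D) ω₁.gnsVector =
        ω₁.gnsRep D ω₁.gnsVector + ω₁.gnsVector := by
      rw [hDsa.star_eq, map_add, map_one, add_apply, one_apply_eq_self, add_comm]
    have e₂ : ω₂.gnsRep ((1 - D) * A) ω₂.gnsVector = η - ω₂.gnsRep D η := by
      rw [map_mul, mul_apply_eq_comp, map_sub, map_one, sub_apply, one_apply_eq_self]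
    rw [e₁, e₂, norm_sub_rev η]
    calc _ ≤ c / (‖η‖ + 1) * ‖η‖ + c / (‖η‖ + 1) := by gcongr
      _ = c := by field_simp
      _ < 2 * c := by linarith
  filter_upwards [hlim.eventually_lt_const hbound, hx.norm_eq_one] with k hk hxk
  -- The terms containing `d k` cancel, and each remaining summand has a factor that is small in the
  -- limit.
  have hsplit : 2 * ⟪x k, Q.rep k (a k) (y k)⟫_ℂ =
      ⟪Q.rep k (1 + star (d k)) (x k), Q.rep k (a k) (y k)⟫_ℂ +
        ⟪x k, Q.rep k ((1 - d k) * a k) (y k)⟫_ℂ := by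
    rw [rep_inner_left, star_add, star_star, star_one, map_mul, mul_apply_eq_comp, map_add,
      map_sub, map_one, add_apply, sub_apply, one_apply_eq_self, inner_add_right, inner_sub_right]
    ring
  have h2 : 2 * ‖⟪x k, Q.rep k (a k) (y k)⟫_ℂ‖ ≤
      ‖Q.rep k (1 + star (d k)) (x k)‖ * ‖Q.rep k (a k) (y k)‖ +
        ‖Q.rep k ((1 - d k) * a k) (y k)‖ := by
    calc 2 * ‖⟪x k, Q.rep k (a k) (y k)⟫_ℂ‖ = ‖2 * ⟪x k, Q.rep k (a k) (y k)⟫_ℂ‖ := by simp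
      _ ≤ _ := by
        rw [hsplit]
        refine (norm_add_le _ _).trans (add_le_add (norm_inner_le_norm _ _) ?_)
        refine (norm_inner_le_norm _ _).trans ?_
        rw [hxk, one_mul]
  linarith

end Limits

end QuasilocalAlgebra

end QuantumMeasurement

end

theorem corollary3p1
    {𝒜 : Type*} [CStarAlgebra 𝒜] [PartialOrder 𝒜] [StarOrderedRing 𝒜]
    {H : ℕ → Type*} [∀ k, NormedAddCommGroup (H k)] [∀ k, InnerProductSpace ℂ (H k)]
    [∀ k, CompleteSpace (H k)]
    (Q : QuantumMeasurement.QuasilocalAlgebra 𝒜 H)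
    (x y : ∀ k, H k) (ω₁ ω₂ : QuantumMeasurement.State 𝒜)
    (hx : Q.WeakStarTendsto x ω₁) (hy : Q.WeakStarTendsto y ω₂)
    (hdisj : QuantumMeasurement.DisjointStates ω₁ ω₂) :
    (∀ (A : 𝒜) (hA : ω₂ (star A * A) ≠ 0),
      ω₂.perturb A hA ∈ QuantumMeasurement.folium ω₂ ∧
      QuantumMeasurement.CoherentStates ω₂ (ω₂.perturb A hA) ∧
      (∀ a : ∀ k, Q.loc k, Q.IsRestriction A a →
        Q.HasTransitionProbability x (Q.perturbVec a y) ω₁ (ω₂.perturb A hA) 0) ∧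
      (∀ u v : ∀ k, H k, Q.WeakStarTendsto u ω₁ → Q.WeakStarTendsto v (ω₂.perturb A hA) →
        Q.HasTransitionProbability u v ω₁ (ω₂.perturb A hA) 0)) ∧
    (∀ (A : 𝒜) (a : ∀ k, Q.loc k), Q.IsRestriction A a →
      Tendsto (fun k => ⟪x k, Q.rep k (a k) (y k)⟫_ℂ) atTop (𝓝 0)) := by
  refine ⟨fun A hA => ⟨ω₂.perturb_mem_folium A hA, ω₂.coherentStates_perturb A hA,
    fun a ha => ?_, fun u v hu hv => ?_⟩, fun A a ha => hx.tendsto_inner_rep_zero hy hdisj ha⟩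
  · exact hx.hasTransitionProbability_zero (hy.perturbVec hA ha) fun ε hε =>
      hdisj.exists_contraction_perturb A hA hε
  · exact hu.hasTransitionProbability_zero hv fun ε hε =>
      hdisj.exists_contraction_perturb A hA hε
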